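/- Let $\mathcal C$ be a triangulated category. For objects $X,Y$ write $X\perp Y$ if $\mathcal C(X,Y)=0$; for a class $D$ of objects put $D^{\perp}=\{Y: X\perp Y\ \forall X\in D\}$ and ${}^{\perp}D=\{Y: Y\perp X\ \forall X\in D\}$. A pair $(L,R)$ of classes of objects is a *torsion theory* if $L^\perp=R$, $L={}^\perp R$, and every object $M$ lies in a distinguished triangle $A\to M\to B\to A[1]$ with $A\in L$, $B\in R$. A *weight structure* $w=(\mathcal C_{w\le 0},\mathcal C_{w\ge 0})=(L,R[-1])$ is given by a torsion theory $(L,R)$ with $L\subset L[1]$; put $\mathcal C_{w\le n}=\mathcal C_{w\le 0}[n]$ and $\mathcal C_{w\ge n}=\mathcal C_{w\ge 0}[n]$. A *$t$-structure* $t=(\mathcal C_{t\le 0},\mathcal C_{t\ge 0})=(R'[1],L')$ (homological convention) is given by a torsion theory $(L',R')$ with $L'\subset L'[-1]$; put $\mathcal C_{t\le n}=\mathcal C_{t\le 0}[n]$, $\mathcal C_{t\ge n}=\mathcal C_{t\ge 0}[n]$, and $\mathcal C[m,n]=\mathcal C_{t\le n}\cap\mathcal C_{t\ge m}$ for $m\le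 n$. The structures $w$ and $t$ are *adjacent* if $\mathcal C_{w\ge 0}=\mathcal C_{t\ge 0}$. An *$n$-weight decomposition* of $M$ is a distinguished triangle $w_{\le n}M\to M\to w_{\ge n+1}M\to (w_{\le n}M)[1]$ with $w_{\le n}M\in\mathcal C_{w\le n}$ and $w_{\ge n+1}M\in \mathcal C_{w\ge n+1}$. For $m\le n$, a morphism $g:M\to N$ *kills weights $m,\dots,n$* if for some $n$-weight decomposition of $M$ and some $(m-1)$-weight decomposition of $N$ there is a morphism $h:w_{\le n}M\to w_{\le m-1}N$ such that the composition $w_{\le n}M\to M\stackrel{g}{\to}N$ equals $w_{\le n}M\stackrel{h}{\to}w_{\le m-1}N\to N$. Let $\mathrm{Mor}_{\cancel{[m,n]}}\mathcal C$ be the class of these morphisms, and let $\mathcal C_{w\notin[m,n]}$ be the class of objects $M$ *without weights $m,\dots,n$*, i.e. such that $\mathrm{id}_M$ kills weights $m,\dots,n$. A pair $(P,J)$ of a class of objects and a class of morphisms is a *projective class* if (i) $J$ is the class of all morphisms $f$ with $\mathcal C(M,f)=0$ for all $M\in P$; (ii) an object $M$ belongs to $P$ if and only if $\mathcal C(M,f)=0$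 for all $f\in J$; (iii) every object $M$ lies in a distinguished triangle $A\to M\stackrel{j}{\to} B\to A[1]$ with $A\in P$, $j\in J$. It is an *injective class* if it is a projective class in $\mathcal C^{op}$. **Theorem.** Let the triangulated category $\mathcal C$ be endowed with a weight structure $w$ and an adjacent $t$-structure $t$, and let $m\le n$ be integers. 1. The pair $(\mathcal C_{w\notin[m,n]},\mathcal C[m,n])$ is a torsion theory. 2. The pair $(\mathcal C_{w\notin[m,n]},J_{[m,n]})$ is a projective class, where $J_{[m,n]}$ is the class of morphisms that factor through an object of $\mathcal C[m,n]$. 3. The pair $(\mathcal C[m,n],\mathrm{Mor}_{\cancel{[m,n]}}\mathcal C)$ is an injective class, and a morphism kills weights $m,\dots,n$ if and only if it factors through an object of $\mathcal C_{w\notin[m,n]}$. -/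

import Mathlib

open CategoryTheory CategoryTheory.Limits CategoryTheory.Pretriangulated
open scoped CategoryTheory.Pretriangulated.Opposite

universe v u

namespace KillWeights

section

variable {C : Type u} [Category.{v} C] [Preadditive C] [HasZeroObject C] [HasShift C ℤ]
  [∀ n : ℤ, (shiftFunctor C n).Additive] [Pretriangulated C]

/-- `(L, R)` is a torsion theory: `L^⊥ = R`, `L = ^⊥R`, and every object `M` lies in a
distinguished triangle `A ⟶ M ⟶ B ⟶ A⟦1⟧` with `A` in `L` and `B` in `R`. -/
structure IsTorsionTheory (L R : ObjectProperty C) : Prop where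
  rightOrthogonal_eq : L.rightOrthogonal = R
  eq_leftOrthogonal : L = R.leftOrthogonal
  exists_triangle (M : C) : ∃ (A B : C) (a : A ⟶ M) (b : M ⟶ B) (c : B ⟶ A⟦(1 : ℤ)⟧),
    L A ∧ R B ∧ Triangle.mk a b c ∈ distTriang C

/-- The translate `P[n]` of an isomorphism-closed class `P`: the class of the objects isomorphic to
`X⟦n⟧` for some `X` in `P`; equivalently, `Y` lies in it if and only if `Y⟦-n⟧` lies in `P`.
It is only applied to the two classes of a torsion theory, which are isomorphism-closed. -/
abbrev translate (P : ObjectProperty C) (n : ℤ) : ObjectProperty C := P.shift (-n)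

variable (C) in
/-- A weight structure on `C` (homological convention), given by the torsion theory `(L, R)`
associated with it, where `L ⊆ L[1]`. The weight structure is the pair
`(C_{w ≤ 0}, C_{w ≥ 0}) = (L, R[-1])`. -/
structure WeightStructure where
  L : ObjectProperty C
  R : ObjectProperty C
  isTorsionTheory : IsTorsionTheory L R
  weighted : L ≤ translate L 1

namespace WeightStructure

variable (w : WeightStructure C)

/-- `C_{w ≤ n} = C_{w ≤ 0}[n] = L[n]`. -/
def le (n : ℤ) : ObjectProperty C := translate w.L n

/-- `C_{w ≥ n} = C_{w ≥ 0}[n] = R[n - 1]`. -/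
def ge (n : ℤ) : ObjectProperty C := translate w.R (n - 1)

/-- `A ⟶ M ⟶ B` is (a part of) an `n`-weight decomposition of `M`, that is,
`A` is a choice of `w_{≤ n} M` and `B` is a choice of `w_{≥ n+1} M`. -/
def IsWeightDecomposition (n : ℤ) {A M B : C} (a : A ⟶ M) (b : M ⟶ B) : Prop :=
  w.le n A ∧ w.ge (n + 1) B ∧ ∃ c : B ⟶ A⟦(1 : ℤ)⟧, Triangle.mk a b c ∈ distTriang C

/-- The class of morphisms `g : M ⟶ N` that kill weights `m, …, n`: for some choice of an
`n`-weight decomposition of `M` and of an `(m-1)`-weight decomposition of `N`, there is `h`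
making the square formed by `h`, `g`, `w_{≤ n} M ⟶ M` and `w_{≤ m-1} N ⟶ N` commutative. -/
def killsWeights (m n : ℤ) : MorphismProperty C := fun M N g =>
  ∃ (A B A' B' : C) (a : A ⟶ M) (b : M ⟶ B) (a' : A' ⟶ N) (b' : N ⟶ B') (h : A ⟶ A'),
    w.IsWeightDecomposition n a b ∧ w.IsWeightDecomposition (m - 1) a' b' ∧ a ≫ g = h ≫ a'

/-- The class `C_{w ∉ [m,n]}` of objects without weights `m, …, n`. -/
def withoutWeights (m n : ℤ) : ObjectProperty C := fun M => w.killsWeights m n (𝟙 M)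

end WeightStructure

/-- `C_{t ≥ n} = C_{t ≥ 0}[n]` in the homological convention (where `C_{t ≥ 0}` is orthogonal to
`C_{t ≤ -1}` from the left). Mathlib uses the cohomological convention, hence the sign. -/
def tGE (t : Triangulated.TStructure C) (n : ℤ) : ObjectProperty C := t.le (-n)

/-- `C_{t ≤ n} = C_{t ≤ 0}[n]` in the homological convention. -/
def tLE (t : Triangulated.TStructure C) (n : ℤ) : ObjectProperty C := t.ge (-n)

/-- `C[m,n] = C_{t ≤ n} ∩ C_{t ≥ m}`. -/
def tInterval (t : Triangulated.TStructure C) (m n : ℤ) : ObjectProperty C :=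
  tLE t n ⊓ tGE t m

/-- `w` and `t` are adjacent: `C_{w ≥ 0} = C_{t ≥ 0}`. -/
def Adjacent (w : WeightStructure C) (t : Triangulated.TStructure C) : Prop :=
  w.ge 0 = tGE t 0

/-- The class of morphisms that factor through an object of `P`. -/
def factorsThrough (P : ObjectProperty C) : MorphismProperty C := fun X Y f =>
  ∃ (Z : C) (a : X ⟶ Z) (b : Z ⟶ Y), P Z ∧ a ≫ b = f

/-- `(P, J)` is a projective class. -/
structure IsProjectiveClass (P : ObjectProperty C) (J : MorphismProperty C) : Prop where
  /-- `J` is the class of all `P`-null morphisms. -/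
  mem_iff_null {X Y : C} (f : X ⟶ Y) :
    J f ↔ ∀ (M : C), P M → ∀ g : M ⟶ X, g ≫ f = 0
  /-- `C(M, -)` annihilates all elements of `J` if and only if `M` belongs to `P`. -/
  annihilates_iff (M : C) :
    (∀ (X Y : C) (f : X ⟶ Y), J f → ∀ g : M ⟶ X, g ≫ f = 0) ↔ P M
  exists_triangle (M : C) : ∃ (A B : C) (i : A ⟶ M) (j : M ⟶ B) (k : B ⟶ A⟦(1 : ℤ)⟧),
    P A ∧ J j ∧ Triangle.mk i j k ∈ distTriang C

/-- `(P, J)` is an injective class: it is a projective class in the triangulated category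
`Cᵒᵖ`. -/
def IsInjectiveClass (P : ObjectProperty C) (J : MorphismProperty C) : Prop :=
  IsProjectiveClass (C := Cᵒᵖ) P.op J.op

end

end KillWeights

namespace KillWeights

open CategoryTheory.Triangulated

section

variable {C : Type u} [Category.{v} C] [Preadditive C] [HasZeroObject C] [HasShift C ℤ]
  [∀ n : ℤ, (shiftFunctor C n).Additive] [Pretriangulated C]

/-! By adjacency, `g` kills weights `m, …, n` exactly when it is annihilated by every map to
`C[m,n]` (`Adjacent.killsWeights_iff`). For identities, this makes the objects without these weights
the left orthogonal of `C[m,n]`. The approximation of `M` in `C[m,n]` is the `t`-truncation `≤ n` of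
`w_{≥ m} M`; the octahedral axiom puts its fibre in that orthogonal (`Adjacent.exists_triangle`).
Closure of `C[m,n]` under retracts completes the torsion theory (`IsTorsionTheory.of_retract`). The
projective and injective classes are formal consequences for any torsion theory. -/

lemma exists_lift_of_distTriang {X Y Z : C} {f : X ⟶ Y} {g : Y ⟶ Z} {h : Z ⟶ X⟦(1 : ℤ)⟧}
    (mem : Triangle.mk f g h ∈ distTriang C) {W : C} (k : W ⟶ Y) (hk : k ≫ g = 0) :
    ∃ l : W ⟶ X, k = l ≫ f :=
  Triangle.coyoneda_exact₂ _ mem k hk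

lemma exists_desc_of_distTriang {X Y Z : C} {f : X ⟶ Y} {g : Y ⟶ Z} {h : Z ⟶ X⟦(1 : ℤ)⟧}
    (mem : Triangle.mk f g h ∈ distTriang C) {W : C} (k : Y ⟶ W) (hk : f ≫ k = 0) :
    ∃ l : Z ⟶ W, k = g ≫ l :=
  Triangle.yoneda_exact₂ _ mem k hk

/-! ### Torsion theories and their projective and injective classes -/

namespace IsTorsionTheory

variable {L R : ObjectProperty C}

lemma zero (h : IsTorsionTheory L R) {X Y : C} (hX : L X) (hY : R Y) (f : X ⟶ Y) : f = 0 := by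
  rw [← h.rightOrthogonal_eq] at hY
  exact hY f hX

lemma isClosedUnderIsomorphisms_left (h : IsTorsionTheory L R) : L.IsClosedUnderIsomorphisms := by
  rw [h.eq_leftOrthogonal]
  infer_instance

lemma isClosedUnderIsomorphisms_right (h : IsTorsionTheory L R) :
    R.IsClosedUnderIsomorphisms := by
  rw [← h.rightOrthogonal_eq]
  infer_instance

lemma exists_triangle_translate (h : IsTorsionTheory L R) (n : ℤ) (M : C) :
    ∃ (A B : C) (a : A ⟶ M) (b : M ⟶ B) (c : B ⟶ A⟦(1 : ℤ)⟧),
      translate L n A ∧ translate R n B ∧ Triangle.mk a b c ∈ distTriang C := by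
  have := h.isClosedUnderIsomorphisms_left
  have := h.isClosedUnderIsomorphisms_right
  obtain ⟨A, B, a, b, c, hA, hB, mem⟩ := h.exists_triangle (M⟦-n⟧)
  let T := (Triangle.shiftFunctor C n).obj (Triangle.mk a b c)
  let e : T.obj₂ ≅ M := shiftNegShift M n
  have hT : Triangle.mk (T.mor₁ ≫ e.hom) (e.inv ≫ T.mor₂) T.mor₃ ∈ distTriang C := by
    refine isomorphic_distinguished _ (Triangle.shift_distinguished _ mem n) _ ?_
    refine Triangle.isoMk _ _ (Iso.refl _) e.symm (Iso.refl _) ?_ ?_ ?_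
    · change (T.mor₁ ≫ e.hom) ≫ e.inv = 𝟙 _ ≫ T.mor₁
      rw [Category.assoc, e.hom_inv_id, Category.comp_id, Category.id_comp]
    · change (e.inv ≫ T.mor₂) ≫ 𝟙 _ = e.inv ≫ T.mor₂
      simp
    · change T.mor₃ ≫ (𝟙 _)⟦(1 : ℤ)⟧' = 𝟙 _ ≫ T.mor₃
      simp
  exact ⟨_, _, _, _, _, L.prop_of_iso (shiftShiftNeg A n).symm hA,
    R.prop_of_iso (shiftShiftNeg B n).symm hB, hT⟩

/-- A morphism is annihilated by all morphisms from `L` if and only if it factors through `R`. -/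
lemma factorsThrough_right_iff (h : IsTorsionTheory L R) {X Y : C} (f : X ⟶ Y) :
    factorsThrough R f ↔ ∀ (M : C), L M → ∀ g : M ⟶ X, g ≫ f = 0 := by
  constructor
  · rintro ⟨Z, a, b, hZ, rfl⟩ M hM g
    rw [← Category.assoc, h.zero hM hZ (g ≫ a), zero_comp]
  · intro hf
    obtain ⟨A, B, a, b, c, hA, hB, mem⟩ := h.exists_triangle X
    obtain ⟨g, hg⟩ := exists_desc_of_distTriang mem f (hf A hA a)
    exact ⟨B, b, g, hB, hg.symm⟩

/-- A morphism is annihilated by all morphisms to `R` if and only if it factors through `L`. -/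
lemma factorsThrough_left_iff (h : IsTorsionTheory L R) {X Y : C} (f : X ⟶ Y) :
    factorsThrough L f ↔ ∀ (M : C), R M → ∀ g : Y ⟶ M, f ≫ g = 0 := by
  constructor
  · rintro ⟨Z, a, b, hZ, rfl⟩ M hM g
    rw [Category.assoc, h.zero hZ hM (b ≫ g), comp_zero]
  · intro hf
    obtain ⟨A, B, a, b, c, hA, hB, mem⟩ := h.exists_triangle Y
    obtain ⟨g, hg⟩ := exists_lift_of_distTriang mem f (hf B hB b)
    exact ⟨A, g, a, hA, hg.symm⟩

/-- Identities of objects of `R` are among the null morphisms, so an object annihilating all of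
these is orthogonal to `R`. -/
theorem isProjectiveClass (h : IsTorsionTheory L R) :
    IsProjectiveClass L (factorsThrough R) where
  mem_iff_null f := h.factorsThrough_right_iff f
  annihilates_iff M := by
    refine ⟨fun hM => ?_, fun hM X Y f hf g => (h.factorsThrough_right_iff f).1 hf M hM g⟩
    rw [h.eq_leftOrthogonal]
    intro Z f hZ
    rw [← Category.comp_id f]
    exact hM Z Z (𝟙 Z) ⟨Z, 𝟙 Z, 𝟙 Z, hZ, Category.comp_id _⟩ f
  exists_triangle M := by
    obtain ⟨A, B, a, b, c, hA, hB, mem⟩ := h.exists_triangle M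
    exact ⟨A, B, a, b, c, hA, ⟨B, b, 𝟙 B, hB, Category.comp_id _⟩, mem⟩

/-- The torsion theory in the opposite category. -/
theorem op (h : IsTorsionTheory L R) : IsTorsionTheory (C := Cᵒᵖ) R.op L.op where
  rightOrthogonal_eq := by
    ext Y
    rw [ObjectProperty.op_iff, h.eq_leftOrthogonal]
    exact ⟨fun hY X f hX => Quiver.Hom.op_inj (hY f.op hX),
      fun hY X f hX => Quiver.Hom.unop_inj (hY f.unop hX)⟩
  eq_leftOrthogonal := by
    ext X
    rw [ObjectProperty.op_iff, ← h.rightOrthogonal_eq]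
    exact ⟨fun hX Y f hY => Quiver.Hom.unop_inj (hX f.unop hY),
      fun hX Y f hY => Quiver.Hom.op_inj (hX f.op hY)⟩
  exists_triangle M := by
    obtain ⟨A, B, a, b, c, hA, hB, mem⟩ := h.exists_triangle M.unop
    exact ⟨_, _, _, _, _, hB, hA, op_distinguished _ mem⟩

theorem isInjectiveClass (h : IsTorsionTheory L R) :
    IsInjectiveClass R (factorsThrough L) := by
  have key : (factorsThrough L).op = factorsThrough (C := Cᵒᵖ) L.op := by
    ext X Y f
    constructor
    · rintro ⟨Z, a, b, hZ, hab⟩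
      exact ⟨Opposite.op Z, b.op, a.op, hZ, Quiver.Hom.unop_inj hab⟩
    · rintro ⟨Z, a, b, hZ, rfl⟩
      exact ⟨Z.unop, b.unop, a.unop, hZ, rfl⟩
  rw [IsInjectiveClass, key]
  exact h.op.isProjectiveClass

end IsTorsionTheory

/-- If `L = ^⊥R`, decompositions exist, and `R` is closed under retracts, then `(L, R)` is a
torsion theory. -/
lemma IsTorsionTheory.of_retract {L R : ObjectProperty C} (hL : L = R.leftOrthogonal)
    (hR : ∀ {X Y : C} (i : X ⟶ Y) (r : Y ⟶ X), i ≫ r = 𝟙 X → R Y → R X)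
    (htri : ∀ M : C, ∃ (A B : C) (a : A ⟶ M) (b : M ⟶ B) (c : B ⟶ A⟦(1 : ℤ)⟧),
      L A ∧ R B ∧ Triangle.mk a b c ∈ distTriang C) : IsTorsionTheory L R where
  rightOrthogonal_eq := by
    ext M
    refine ⟨fun hM => ?_, fun hM X f hX => ?_⟩
    · obtain ⟨A, B, a, b, c, hA, hB, mem⟩ := htri M
      -- As `a` vanishes, `b` is a split monomorphism and `M` is a retract of `B`.
      obtain ⟨r, hr⟩ := exists_desc_of_distTriang mem (𝟙 M)
        (show a ≫ 𝟙 M = 0 by rw [hM a hA, zero_comp])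
      exact hR b r hr.symm hB
    · rw [hL] at hX
      exact hX f hM
  eq_leftOrthogonal := hL
  exists_triangle := htri

/-! ### Killing weights as an orthogonality condition -/

namespace WeightStructure

variable (w : WeightStructure C)

lemma zero (n : ℤ) {X Y : C} (hX : w.le n X) (hY : w.ge (n + 1) Y) (f : X ⟶ Y) : f = 0 := by
  apply (shiftFunctor C (-n)).map_injective
  rw [Functor.map_zero]
  refine w.isTorsionTheory.zero hX ?_ _
  rw [ge, add_sub_cancel_right] at hY
  exact hY

lemma exists_isWeightDecomposition (n : ℤ) (M : C) :
    ∃ (A B : C) (a : A ⟶ M) (b : M ⟶ B), w.IsWeightDecomposition n a b := by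
  obtain ⟨A, B, a, b, c, hA, hB, mem⟩ := w.isTorsionTheory.exists_triangle_translate n M
  refine ⟨A, B, a, b, hA, ?_, c, mem⟩
  rw [ge, add_sub_cancel_right]
  exact hB

/-- A morphism kills weights `m, …, n` if and only if all the compositions
`A ⟶ M ⟶ N ⟶ B` with `A` of weight `≤ n` and `B` of weight `≥ m` vanish. -/
lemma killsWeights_iff (m n : ℤ) {M N : C} (g : M ⟶ N) :
    w.killsWeights m n g ↔ ∀ ⦃A B : C⦄ (a : A ⟶ M) (b : N ⟶ B),
      w.le n A → w.ge m B → a ≫ g ≫ b = 0 := by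
  constructor
  · rintro ⟨A', B', A'', B'', a', b', a'', b'', h, ⟨-, hB', c', mem'⟩, ⟨hA'', -, -⟩, comm⟩
      A B a b hA hB
    -- Any `a` factors through the given `w_{≤ n} M`, so the choice of decompositions is immaterial.
    obtain ⟨f, rfl⟩ := exists_lift_of_distTriang mem' a (w.zero n hA hB' (a ≫ b'))
    have hz : a'' ≫ b = 0 := w.zero (m - 1) hA'' (by rwa [sub_add_cancel]) _
    rw [Category.assoc, reassoc_of% comm, hz, comp_zero, comp_zero]
  · intro hg
    obtain ⟨A, B, a, b, hab⟩ := w.exists_isWeightDecomposition n M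
    obtain ⟨A', B', a', b', hab'⟩ := w.exists_isWeightDecomposition (m - 1) N
    obtain ⟨c', mem'⟩ := hab'.2.2
    have hB' := hab'.2.1
    rw [sub_add_cancel] at hB'
    obtain ⟨h, hh⟩ := exists_lift_of_distTriang mem' (a ≫ g)
      ((Category.assoc _ _ _).trans (hg a b' hab.1 hB'))
    exact ⟨A, B, A', B', a, b, a', b', h, hab, hab', hh⟩

end WeightStructure

/-! ### The classes `C[m,n]` of the `t`-structure -/

lemma tInterval_iff (t : TStructure C) (m n : ℤ) (X : C) :
    tInterval t m n X ↔ t.IsGE X (-n) ∧ t.IsLE X (-m) :=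
  and_congr (t.ge_iff_isGE X _) (t.le_iff_isLE X _)

lemma tInterval_of_retract (t : TStructure C) (m n : ℤ) {X Y : C} (i : X ⟶ Y) (r : Y ⟶ X)
    (hir : i ≫ r = 𝟙 X) (hY : tInterval t m n Y) : tInterval t m n X := by
  rw [tInterval_iff] at hY ⊢
  obtain ⟨_, _⟩ := hY
  constructor
  · rw [t.isGE_iff_orthogonal (-n - 1) (-n) (by lia)]
    intro Z f _
    rw [← Category.comp_id f, ← hir, ← Category.assoc, t.zero (f ≫ i) (-n - 1) (-n), zero_comp]
  · rw [t.isLE_iff_orthogonal (-m) (-m + 1) rfl]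
    intro Z f _
    rw [← Category.id_comp f, ← hir, Category.assoc, t.zero (r ≫ f) (-m) (-m + 1), comp_zero]

/-- An object of `C_{t ≥ m}` is an extension of an object of `C[m,n]` by an object
of `C_{t ≥ n+1}`. -/
lemma exists_triangle_tInterval (t : TStructure C) {m n : ℤ} (hmn : m ≤ n) {B : C}
    (hB : tGE t m B) :
    ∃ (X Y : C) (x : X ⟶ B) (y : B ⟶ Y) (z : Y ⟶ X⟦(1 : ℤ)⟧), tGE t (n + 1) X ∧
      tInterval t m n Y ∧ Triangle.mk x y z ∈ distTriang C := by
  obtain ⟨X, Y, hX, hY, x, y, z, mem⟩ := t.exists_triangle B (-(n + 1)) (-n) (by lia)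
  refine ⟨X, Y, x, y, z, hX, ⟨hY, ?_⟩, mem⟩
  have : t.IsLE X (-(n + 1)) := ⟨hX⟩
  -- `X⟦1⟧` lies in `C_{t ≥ n+2}`, hence in `C_{t ≥ m}` by `m ≤ n`; `Y` is an extension of it by
  -- `B`.
  have : t.IsLE (X⟦(1 : ℤ)⟧) (-m) := by
    have := t.isLE_shift X (-(n + 1)) 1 (-(n + 1) - 1)
    exact t.isLE_of_le _ (-(n + 1) - 1) (-m)
  exact (t.isLE₂ _ (rot_of_distTriang _ mem) (-m) ⟨hB⟩ this).le

/-! ### Adjacent structures -/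

section Adjacent

variable {w : WeightStructure C} {t : TStructure C}

lemma Adjacent.ge_eq (hwt : Adjacent w t) (n : ℤ) : w.ge n = tGE t n := by
  have := w.isTorsionTheory.isClosedUnderIsomorphisms_right
  -- The translate of `R` by `0 - 1` is its shift by `-(0 - 1)`, which computes to `1`.
  have h : w.R.shift (1 : ℤ) = t.le 0 := hwt
  rw [tGE, ← t.shift_le (-n) 0 (-n) (by lia), ← h, w.R.shift_shift (-n) 1 (-(n - 1)) (by lia)]
  rfl

/-- Forward, `g ≫ z` vanishes on `w_{≤ n} M`, so it factors through `w_{≥ n+1} M`, which has no maps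
to `C_{t ≤ n}`. Conversely, truncating `B` lifts the composition to an object of `C_{t ≥ n+1} = C_{w
≥ n+1}`, orthogonal to `A`. -/
lemma Adjacent.killsWeights_iff (hwt : Adjacent w t) {m n : ℤ} (hmn : m ≤ n) {M N : C}
    (g : M ⟶ N) :
    w.killsWeights m n g ↔ ∀ (Z : C), tInterval t m n Z → ∀ z : N ⟶ Z, g ≫ z = 0 := by
  rw [w.killsWeights_iff]
  constructor
  · intro hg Z hZ z
    obtain ⟨A, B, a, b, hA, hB, c, mem⟩ := w.exists_isWeightDecomposition n M
    obtain ⟨f, hf⟩ := exists_desc_of_distTriang mem (g ≫ z)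
      (hg a z hA (by rw [hwt.ge_eq]; exact hZ.2))
    rw [hwt.ge_eq] at hB
    have hf0 : f = 0 :=
      t.zero_of_isLE_of_isGE f (-(n + 1)) (-n) (by lia) ⟨hB⟩ ⟨hZ.1⟩
    rw [hf, hf0, comp_zero]
  · intro hg A B a b hA hB
    rw [hwt.ge_eq] at hB
    obtain ⟨X, Y, x, y, z, hX, hY, mem⟩ := exists_triangle_tInterval t hmn hB
    rw [← hwt.ge_eq] at hX
    have h0 : (a ≫ g ≫ b) ≫ y = 0 := by
      rw [Category.assoc, Category.assoc, hg Y hY (b ≫ y), comp_zero]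
    obtain ⟨f, hf⟩ := exists_lift_of_distTriang mem (a ≫ g ≫ b) h0
    have hf0 : f = 0 := w.zero n hA hX f
    rw [hf, hf0, zero_comp]

lemma Adjacent.withoutWeights_eq (hwt : Adjacent w t) {m n : ℤ} (hmn : m ≤ n) :
    w.withoutWeights m n = (tInterval t m n).leftOrthogonal := by
  ext M
  refine (hwt.killsWeights_iff hmn (𝟙 M)).trans ?_
  simp only [Category.id_comp]
  exact ⟨fun h Y f hY => h Y hY f, fun h Y hY f => h f hY⟩

lemma Adjacent.exists_triangle [IsTriangulated C] (hwt : Adjacent w t) {m n : ℤ} (hmn : m ≤ n)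
    (M : C) : ∃ (F Y : C) (a : F ⟶ M) (b : M ⟶ Y) (c : Y ⟶ F⟦(1 : ℤ)⟧),
      (tInterval t m n).leftOrthogonal F ∧ tInterval t m n Y ∧
        Triangle.mk a b c ∈ distTriang C := by
  obtain ⟨P, B, p, b, hP, hB, c, mem⟩ := w.exists_isWeightDecomposition (m - 1) M
  rw [sub_add_cancel, hwt.ge_eq] at hB
  obtain ⟨X, Y, x, y, z, hX, hY, mem'⟩ := exists_triangle_tInterval t hmn hB
  obtain ⟨F, i, d, mem''⟩ := distinguished_cocone_triangle₁ (b ≫ y)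
  refine ⟨F, Y, i, b ≫ y, d, fun Z f hZ => ?_, hY, mem''⟩
  -- The octahedron gives a triangle `P⟦1⟧ ⟶ F⟦1⟧ ⟶ X⟦1⟧`: a map `F ⟶ Z` vanishes because there are
  -- none from `P` (weights) or from `X` (`t`-structure).
  let o := someOctahedron rfl (rot_of_distTriang _ mem)
    (rot_of_distTriang _ mem') (rot_of_distTriang _ mem'')
  apply (shiftFunctor C (1 : ℤ)).map_injective
  rw [Functor.map_zero]
  have h₁ : o.m₁ ≫ f⟦(1 : ℤ)⟧' = 0 := by
    obtain ⟨k, hk⟩ := (shiftFunctor C (1 : ℤ)).map_surjective (o.m₁ ≫ f⟦(1 : ℤ)⟧')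
    have hk0 : k = 0 := w.zero (m - 1) hP (by rw [sub_add_cancel, hwt.ge_eq]; exact hZ.2) k
    rw [← hk, hk0, Functor.map_zero]
  obtain ⟨l, hl⟩ := exists_desc_of_distTriang o.mem (f⟦(1 : ℤ)⟧') h₁
  obtain ⟨k, rfl⟩ := (shiftFunctor C (1 : ℤ)).map_surjective l
  have hk0 : k = 0 := t.zero_of_isLE_of_isGE k (-(n + 1)) (-n) (by lia) ⟨hX⟩ ⟨hZ.1⟩
  exact hl.trans (by rw [hk0, Functor.map_zero]; exact comp_zero)

theorem Adjacent.isTorsionTheory [IsTriangulated C] (hwt : Adjacent w t) {m n : ℤ}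
    (hmn : m ≤ n) : IsTorsionTheory (w.withoutWeights m n) (tInterval t m n) :=
  .of_retract (hwt.withoutWeights_eq hmn) (tInterval_of_retract t m n) (by
    rw [hwt.withoutWeights_eq hmn]
    exact hwt.exists_triangle hmn)

theorem Adjacent.killsWeights_eq [IsTriangulated C] (hwt : Adjacent w t) {m n : ℤ}
    (hmn : m ≤ n) : w.killsWeights m n = factorsThrough (w.withoutWeights m n) := by
  ext M N g
  rw [hwt.killsWeights_iff hmn, (hwt.isTorsionTheory hmn).factorsThrough_left_iff]

end Adjacent

end

end KillWeights

theorem theorem3p4 {C : Type u} [Category.{v} C] [Preadditive C] [HasZeroObject C]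
    [HasShift C ℤ] [∀ n : ℤ, (shiftFunctor C n).Additive] [Pretriangulated C]
    [IsTriangulated C] (w : KillWeights.WeightStructure C)
    (t : Triangulated.TStructure C) (hwt : KillWeights.Adjacent w t)
    (m n : ℤ) (hmn : m ≤ n) :
    KillWeights.IsTorsionTheory (w.withoutWeights m n) (KillWeights.tInterval t m n) ∧
    KillWeights.IsProjectiveClass (w.withoutWeights m n)
      (KillWeights.factorsThrough (KillWeights.tInterval t m n)) ∧
    KillWeights.IsInjectiveClass (KillWeights.tInterval t m n) (w.killsWeights m n) ∧
    w.killsWeights m n = KillWeights.factorsThrough (w.withoutWeights m n) := by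
  have h := hwt.isTorsionTheory hmn
  have hk := hwt.killsWeights_eq hmn
  exact ⟨h, h.isProjectiveClass, hk ▸ h.isInjectiveClass, hk⟩
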